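/- Definitions. All spaces are complex Hilbert spaces, possibly infinite-dimensional. A *quantum query algorithm* $A=A(O)$ in a space $\mathcal X=\mathcal X^\circ\oplus(\mathcal X^\uparrow\otimes\mathcal M)$ with input oracle a unitary $O$ on $\mathcal M$ is a product $A(O)=U_Q\widetilde O\,U_{Q-1}\widetilde O\cdots U_1\widetilde O\,U_0$, where $U_0,\dots,U_Q$ are unitaries on $\mathcal X$ that do not depend on $O$, and $\widetilde O=I\oplus(I\otimes O)$. Its Las Vegas query complexity on $\psi\in\mathcal X$ is $L(A,O,\psi)=\sum_{t=1}^{Q}\|\psi_t^\bullet\|^2$, where $\psi_t^\bullet$ is the component in $\mathcal X^\uparrow\otimes\mathcal M$ of the state $U_{t-1}\widetilde O\cdots\widetilde O\,U_0\psi$ right before the $t$-th query. A *transducer* $S=S(O)$ with public space $\mathcal H$ and private space $\mathcal L$ is a unitary on $\mathcal H\oplus\mathcal L$ given by such an algorithm in $\mathcal X=\mathcal H\oplus\mathcal L$. It *transduces* $\xi\in\mathcal H$ into $\tau\in\mathcal H$ with *catalyst* $v\in\mathcal L$, written $S(O)\colon\xi\rightsquigarrow\tau$, if $S(O)(\xi\oplus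 v)=\tau\oplus v$; the *query complexity* of this transduction is $L(S,O,\xi)=L(S,O,\xi\oplus v)$, and its *transduction complexity* is $W(S,O,\xi)=\|v\|^2$. Statement. There is an absolute constant $C>0$ such that the following holds. Let $\mathcal A=\mathbb C^2$ be a qubit and let $\mathcal W$ be a Hilbert space with a fixed unit vector $|0\rangle_{\mathcal W}$. There is a transducer $S_{\mathrm{pur}}$ with public space $\mathbb C^2$ and an infinite-dimensional private space, whose input oracle acts on $(\mathcal A\otimes\mathcal W)\oplus(\mathcal A\otimes\mathcal W)$, such that for every unitary $O$ on $\mathcal A\otimes\mathcal W$ and every $p\in[0,1]$, $p\neq\frac12$, with $$O\colon |0\rangle_{\mathcal A}|0\rangle_{\mathcal W}\longmapsto\sqrt{1-p}\,|0\rangle_{\mathcal A}|\phi_0\rangle_{\mathcal W}+\sqrt p\,|1\rangle_{\mathcal A}|\phi_1\rangle_{\mathcal W}$$ for some unit vectors $\phi_0,\phi_1\in\mathcal W$, the transducer with bidirectional access to $O$, that is, with input oracle $O\oplus O^*$, performs exactly the transduction $$S_{\mathrm{pur}}(O\oplus O^*)\colon|0\rangle\rightsquigarrow\begin{cases}|0\rangle,&\text{if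 }p<\frac12,\\|1\rangle,&\text{if }p>\frac12,\end{cases}$$ with a catalyst for which, with $\delta=|\frac12-p|$, $$L\bigl(S_{\mathrm{pur}},O\oplus O^*,|0\rangle\bigr)=1+\frac1{2\delta}\qquad\text{and}\qquad W\bigl(S_{\mathrm{pur}},O\oplus O^*,|0\rangle\bigr)\le\frac C\delta.$$ -/

import Mathlib

universe u v w

noncomputable section

/-! ### Spaces

Hilbert direct sums are `WithLp 2 (E × F)`.  The Hilbert tensor product of `ℓ²(ι)` with `M` is the
space `ℓ²(ι, M)` of square-summable families in `M`; for a qubit this is `M ⊕ M`. -/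

/-- `ℓ²(ι) ⊗ M`, as the space of square-summable `M`-valued families. -/
abbrev Amplify (ι : Type v) (M : Type w) [NormedAddCommGroup M] : Type (max v w) :=
  lp (fun _ : ι => M) 2

/-- The operator `I ⊗ O` on `ℓ²(ι) ⊗ M`: it applies the unitary `O` to every component. -/
def idTensor (ι : Type v) {M : Type w} [NormedAddCommGroup M] [InnerProductSpace ℂ M]
    (O : M ≃ₗᵢ[ℂ] M) : Amplify ι M ≃ₗᵢ[ℂ] Amplify ι M where
  toFun f := ⟨fun i => O (f i), (memℓp_norm_iff.1 (by
    simpa only [O.norm_map] using memℓp_norm_iff.2 (lp.memℓp f)))⟩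
  invFun f := ⟨fun i => O.symm (f i), (memℓp_norm_iff.1 (by
    simpa only [O.symm.norm_map] using memℓp_norm_iff.2 (lp.memℓp f)))⟩
  map_add' f g := by ext i; exact O.map_add (f i) (g i)
  map_smul' c f := by ext i; simp
  left_inv f := by ext i; simp
  right_inv f := by ext i; simp
  norm_map' f := by
    have h2 : (0 : ℝ) < (2 : ENNReal).toReal := by norm_num
    rw [lp.norm_eq_tsum_rpow h2, lp.norm_eq_tsum_rpow h2]
    simp

@[simp]
theorem idTensor_apply (ι : Type v) {M : Type w} [NormedAddCommGroup M] [InnerProductSpace ℂ M]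
    (O : M ≃ₗᵢ[ℂ] M) (f : Amplify ι M) (i : ι) : idTensor ι O f i = O (f i) := rfl

/-- A qubit. -/
abbrev Qubit : Type := EuclideanSpace ℂ (Fin 2)

/-- The basis state `|b⟩` of a qubit. -/
def ket (b : Fin 2) : Qubit := EuclideanSpace.single b 1

/-- The space `A ⊗ W`, where `A` is a qubit, as the direct sum of two copies of `W`. -/
abbrev QubitTensor (W : Type w) : Type w := PiLp 2 (fun _ : Fin 2 => W)

/-- The vector `|b⟩ ⊗ x` of `A ⊗ W`. -/
def ketTensor {W : Type w} [NormedAddCommGroup W] (b : Fin 2) (x : W) : QubitTensor W :=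
  PiLp.single 2 b x

/-- The unitary `O ⊕ O*`. -/
def bidirectional {M : Type w} [NormedAddCommGroup M] [InnerProductSpace ℂ M]
    (O : M ≃ₗᵢ[ℂ] M) : WithLp 2 (M × M) ≃ₗᵢ[ℂ] WithLp 2 (M × M) :=
  LinearIsometryEquiv.withLpProdCongr 2 O O.symm

/-! ### Quantum query algorithms -/

/-- A quantum query algorithm in the space `X` whose input oracle acts on `M`.  The space `X` is
decomposed as `Work ⊕ (ℓ²(Idx) ⊗ M)`, and the algorithm is the product
`U_Q Õ U_{Q-1} Õ ⋯ Õ U_0` of input-independent unitaries `U_t` and of queries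
`Õ = I ⊕ (I ⊗ O)`.  (Only the unitaries `U_t` with `t ≤ Q` are used.) -/
structure QueryAlgorithm (M : Type w) [NormedAddCommGroup M] [InnerProductSpace ℂ M]
    (X : Type u) [NormedAddCommGroup X] [InnerProductSpace ℂ X] where
  /-- the part of the space that the oracle does not act on -/
  Work : Type u
  [normedAddCommGroupWork : NormedAddCommGroup Work]
  [innerProductSpaceWork : InnerProductSpace ℂ Work]
  /-- labels of an orthonormal basis of the register that accompanies `M` -/
  Idx : Type v
  /-- the decomposition of the space into its work part and its query part -/
  decomp : X ≃ₗᵢ[ℂ] WithLp 2 (Work × Amplify Idx M)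
  /-- the number of queries -/
  numQueries : ℕ
  /-- the input-independent unitaries -/
  U : ℕ → (X ≃ₗᵢ[ℂ] X)

attribute [instance] QueryAlgorithm.normedAddCommGroupWork QueryAlgorithm.innerProductSpaceWork

namespace QueryAlgorithm

variable {M : Type w} [NormedAddCommGroup M] [InnerProductSpace ℂ M]
  {X : Type u} [NormedAddCommGroup X] [InnerProductSpace ℂ X]

/-- The query operator `Õ = I ⊕ (I ⊗ O)`. -/
def queryOperator (A : QueryAlgorithm.{u, v, w} M X) (O : M ≃ₗᵢ[ℂ] M) : X ≃ₗᵢ[ℂ] X :=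
  (A.decomp.trans (LinearIsometryEquiv.withLpProdCongr 2
    (LinearIsometryEquiv.refl ℂ A.Work) (idTensor A.Idx O))).trans A.decomp.symm

/-- The unitary `U_t Õ U_{t-1} Õ ⋯ Õ U_0`. -/
def evolve (A : QueryAlgorithm.{u, v, w} M X) (O : M ≃ₗᵢ[ℂ] M) : ℕ → (X ≃ₗᵢ[ℂ] X)
  | 0 => A.U 0
  | t + 1 => ((A.evolve O t).trans (A.queryOperator O)).trans (A.U (t + 1))

/-- The action `A(O)` of the algorithm on the input oracle `O`. -/
def action (A : QueryAlgorithm.{u, v, w} M X) (O : M ≃ₗᵢ[ℂ] M) : X ≃ₗᵢ[ℂ] X :=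
  A.evolve O A.numQueries

/-- The component in the query part `ℓ²(Idx) ⊗ M` of the state right before the query number
`t + 1`, when the initial state is `ξ`. -/
def queryState (A : QueryAlgorithm.{u, v, w} M X) (O : M ≃ₗᵢ[ℂ] M) (ξ : X) (t : ℕ) :
    Amplify A.Idx M :=
  (A.decomp (A.evolve O t ξ)).snd

/-- The Las Vegas query complexity `L(A, O, ξ)`: the sum over all queries of the squared norm of
the part of the state that the query is applied to. -/
def lasVegas (A : QueryAlgorithm.{u, v, w} M X) (O : M ≃ₗᵢ[ℂ] M) (ξ : X) : ℝ :=
  ∑ t ∈ Finset.range A.numQueries, ‖A.queryState O ξ t‖ ^ 2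

end QueryAlgorithm

/-! ### Transducers -/

/-- A transducer with public space `H`, private space `L` and an input oracle on `M`: a unitary
`S(O)` on `H ⊕ L`, given by an implementation as a query algorithm. -/
structure Transducer (M : Type w) [NormedAddCommGroup M] [InnerProductSpace ℂ M]
    (H : Type) [NormedAddCommGroup H] [InnerProductSpace ℂ H]
    (L : Type u) [NormedAddCommGroup L] [InnerProductSpace ℂ L] where
  /-- the implementation of the transducer -/
  impl : QueryAlgorithm.{u, v, w} M (WithLp 2 (H × L))

namespace Transducer

variable {M : Type w} [NormedAddCommGroup M] [InnerProductSpace ℂ M]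
  {H : Type} [NormedAddCommGroup H] [InnerProductSpace ℂ H]
  {L : Type u} [NormedAddCommGroup L] [InnerProductSpace ℂ L]

/-- `S(O)` transduces `ξ` into `τ` with catalyst `c`, that is, `S(O) : ξ ⊕ c ↦ τ ⊕ c`. -/
def Transduces (S : Transducer.{u, v, w} M H L) (O : M ≃ₗᵢ[ℂ] M) (ξ τ : H) (c : L) : Prop :=
  S.impl.action O (WithLp.toLp 2 (ξ, c)) = WithLp.toLp 2 (τ, c)

/-- The query complexity `L(S, O, ξ)` of a transduction with catalyst `c`: the Las Vegas query
complexity of the implementation on the initial coupling `ξ ⊕ c`. -/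
def queryComplexity (S : Transducer.{u, v, w} M H L) (O : M ≃ₗᵢ[ℂ] M) (ξ : H) (c : L) : ℝ :=
  S.impl.lasVegas O (WithLp.toLp 2 (ξ, c))

end Transducer

/-- The transduction complexity of a transduction with catalyst `c`. -/
def transductionComplexity {L : Type u} [NormedAddCommGroup L] (c : L) : ℝ := ‖c‖ ^ 2

/-- `O` is a state-generating oracle on `A ⊗ W` with acceptance probability `p`:
`O (|0⟩ ⊗ w₀) = √(1 - p) |0⟩ ⊗ φ₀ + √p |1⟩ ⊗ φ₁` with normalised `φ₀` and `φ₁`, where the unit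
vector `w₀` is the initial state `|0⟩` of `W`. -/
def IsStateGenerating {W : Type w} [NormedAddCommGroup W] [InnerProductSpace ℂ W] (w₀ : W)
    (O : QubitTensor W ≃ₗᵢ[ℂ] QubitTensor W) (p : ℝ) : Prop :=
  0 ≤ p ∧ p ≤ 1 ∧ ∃ φ₀ φ₁ : W, ‖φ₀‖ = 1 ∧ ‖φ₁‖ = 1 ∧
    O (ketTensor 0 w₀) =
      (Real.sqrt (1 - p) : ℂ) • ketTensor 0 φ₀ + (Real.sqrt p : ℂ) • ketTensor 1 φ₁

end

noncomputable section

/-! With `x = √(1 - p)` and `y = √p`, the oracle sends `|0⟩w₀` to `x|0⟩φ₀ + y|1⟩φ₁`. The preimage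
`d` of `y|0⟩φ₀ - x|1⟩φ₁` is a unit vector orthogonal to `|0⟩w₀`. On this plane `O` is thus the
orthogonal matrix with rows `(x, y)` and `(y, -x)`. The algorithm knows neither `p` nor `d`, but it
can tell `|0⟩` from `|1⟩` after `O`, and `|0⟩w₀` from its orthogonal complement after `O*`. So it
can move the labels of the two components of a state independently in either picture.

The labels form two lines, and a state is given by coefficients `f`, `g` on `|0⟩w₀` and `d`. One
round applies `O`, signed permutations of labels depending on the qubit, `O*`, and signed shifts
depending on `|0⟩w₀` versus `d` (`purifier_step`). The public `|b⟩` enters or leaves at a port on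
line `b`. A catalyst is then a square-summable solution of linear recurrences for `f` and `g`
(`exists_catalyst`). These have a geometric solution of ratio `y/x` whose unit amplitude returns to
port `0`, and one of ratio `x/y` whose unit amplitude emerges at port `1`. The first is
square-summable for `p < 1/2`, the second for `p > 1/2`.

In both cases the amplitudes, up to sign, are `1, r, r², …`, of total squared norm `T = 1/(1 - r²)`.
The initial exchange puts the public `|0⟩` into the query register, so both queries act on the
entire state. Hence the query complexity is exactly `2T = 1 + 1/(2δ)`, and the catalyst, which lacks
only the unit amplitude at the port, has squared norm `T - 1`. -/

/-- The reflection in the orthogonal complement of `u - v`, which exchanges orthonormal `u`, `v`. -/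
def exchange {E : Type u} [NormedAddCommGroup E] [InnerProductSpace ℂ E] (u v : E) : E ≃ₗᵢ[ℂ] E :=
  (ℂ ∙ (u - v))ᗮ.reflection

/-! ### Exchange of two orthonormal vectors -/

section exchange

variable {E : Type u} [NormedAddCommGroup E] [InnerProductSpace ℂ E] {u v x : E}

theorem exchange_of_orthogonal (hu : inner ℂ u x = 0) (hv : inner ℂ v x = 0) :
    exchange u v x = x := by
  refine Submodule.reflection_mem_subspace_eq_self ?_
  rw [Submodule.mem_orthogonal_singleton_iff_inner_right, inner_sub_left, hu, hv, sub_zero]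

/-- The reflection negates `u - v` and fixes `u + v`, which is orthogonal to `u - v` as `u` and `v`
are orthonormal. Adding the two images gives twice the image of `u`. -/
theorem exchange_left (hu : ‖u‖ = 1) (hv : ‖v‖ = 1) (h : inner ℂ u v = 0) :
    exchange u v u = v := by
  have h' : inner ℂ v u = 0 := inner_eq_zero_symm.1 h
  have h1 : exchange u v (u - v) = -(u - v) :=
    Submodule.reflection_orthogonalComplement_singleton_eq_neg _
  have h2 : exchange u v (u + v) = u + v := by
    refine Submodule.reflection_mem_subspace_eq_self ?_
    rw [Submodule.mem_orthogonal_singleton_iff_inner_right, inner_sub_left, inner_add_right,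
      inner_add_right, h, h', inner_self_eq_norm_sq_to_K, inner_self_eq_norm_sq_to_K, hu, hv]
    simp
  rw [map_sub] at h1
  rw [map_add] at h2
  have h3 : (2 : ℂ) • exchange u v u = (2 : ℂ) • v := by
    rw [two_smul, two_smul]
    have := congrArg₂ (· + ·) h1 h2
    calc _ = exchange u v u - exchange u v v + (exchange u v u + exchange u v v) := by abel
      _ = -(u - v) + (u + v) := this
      _ = v + v := by abel
  exact smul_right_injective E (two_ne_zero : (2 : ℂ) ≠ 0) h3

theorem exchange_exchange : exchange u v (exchange u v x) = x :=
  Submodule.reflection_reflection _ _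

theorem exchange_right (hu : ‖u‖ = 1) (hv : ‖v‖ = 1) (h : inner ℂ u v = 0) :
    exchange u v v = u := by
  have := exchange_exchange (u := u) (v := v) (x := u)
  rwa [exchange_left hu hv h] at this

end exchange

/-! ### Signed permutations and exchanges in Hilbert sums -/

theorem withLp_prod_ext {M : Type v} {N : Type w} {x y : WithLp 2 (M × N)}
    (h₁ : x.fst = y.fst) (h₂ : x.snd = y.snd) : x = y :=
  (WithLp.equiv 2 (M × N)).injective (Prod.ext h₁ h₂)

/-- Square-summable families with values in a Hilbert space, given by the sum of the squares. -/
theorem memℓp_two_of_summable {ι : Type v} {M : Type w} [NormedAddCommGroup M] {f : ι → M}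
    (h : Summable fun i => ‖f i‖ ^ 2) : Memℓp f 2 :=
  memℓp_gen (by simpa using h)

theorem Amplify.hasSum_norm_sq {ι : Type v} {M : Type w} [NormedAddCommGroup M]
    (f : Amplify ι M) : HasSum (fun i => ‖f i‖ ^ 2) (‖f‖ ^ 2) := by
  have := lp.hasSum_norm (p := 2) (by norm_num) f
  simp only [ENNReal.toReal_ofNat, Real.rpow_ofNat] at this
  exact this

/-- The unitary on `ℓ²(ι) ⊗ (M ⊕ M)` that acts on the two copies of `ℓ²(ι) ⊗ M` by two signed
permutations of `ι`. -/
def signedPermPair {ι : Type v} {M : Type w} [NormedAddCommGroup M] [InnerProductSpace ℂ M]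
    (σ τ : Equiv.Perm ι) (s t : ι → ℤˣ) :
    Amplify ι (WithLp 2 (M × M)) ≃ₗᵢ[ℂ] Amplify ι (WithLp 2 (M × M)) :=
  -- Stated for arbitrary permutations and signs, so that it gives square-summability for the
  -- inverse as well as for the map itself.
  have key (σ τ : Equiv.Perm ι) (s t : ι → ℤˣ) (f : Amplify ι (WithLp 2 (M × M))) :
      HasSum (fun i => ‖WithLp.toLp 2 (s i • (f (σ i)).fst, t i • (f (τ i)).snd)‖ ^ 2)
        (‖f‖ ^ 2) := by
    have hsq : HasSum (fun i => ‖(f i).fst‖ ^ 2 + ‖(f i).snd‖ ^ 2) (‖f‖ ^ 2) :=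
      (funext fun i => WithLp.prod_norm_sq_eq_of_L2 (f i)) ▸ Amplify.hasSum_norm_sq f
    have h1 : Summable fun i => ‖(f i).fst‖ ^ 2 :=
      hsq.summable.of_nonneg_of_le (fun i => by positivity) (fun i => by simp)
    have h2 : Summable fun i => ‖(f i).snd‖ ^ 2 :=
      hsq.summable.of_nonneg_of_le (fun i => by positivity) (fun i => by simp)
    have hn (u : ℤˣ) (m : M) : ‖u • m‖ = ‖m‖ := by
      rcases Int.units_eq_one_or u with rfl | rfl <;> simp
    have hi (i : ι) : ‖WithLp.toLp 2 (s i • (f (σ i)).fst, t i • (f (τ i)).snd)‖ ^ 2 =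
        ‖(f (σ i)).fst‖ ^ 2 + ‖(f (τ i)).snd‖ ^ 2 := by
      rw [WithLp.prod_norm_sq_eq_of_L2]
      exact congrArg₂ (fun a b : ℝ => a ^ 2 + b ^ 2) (hn _ _) (hn _ _)
    rw [hsq.unique (h1.hasSum.add h2.hasSum), funext hi]
    exact (σ.hasSum_iff.2 h1.hasSum).add (τ.hasSum_iff.2 h2.hasSum)
  have hsu (u : ℤˣ) (m : M) : u • u • m = m := by
    rcases Int.units_eq_one_or u with rfl | rfl <;> simp
  { toFun f := ⟨fun i => WithLp.toLp 2 (s i • (f (σ i)).fst, t i • (f (τ i)).snd),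
      memℓp_two_of_summable (key σ τ s t f).summable⟩
    invFun f := ⟨fun i => WithLp.toLp 2 (s (σ.symm i) • (f (σ.symm i)).fst,
      t (τ.symm i) • (f (τ.symm i)).snd),
      memℓp_two_of_summable (key σ.symm τ.symm (s ∘ σ.symm) (t ∘ τ.symm) f).summable⟩
    map_add' f g := by
      ext i
      refine withLp_prod_ext ?_ ?_
      · exact smul_add _ _ _
      · exact smul_add _ _ _
    map_smul' c f := by
      ext i
      refine withLp_prod_ext ?_ ?_
      · exact smul_comm _ c _
      · exact smul_comm _ c _
    left_inv f := by
      ext i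
      refine withLp_prod_ext ?_ ?_
      · simp [hsu]
      · simp [hsu]
    right_inv f := by
      ext i
      refine withLp_prod_ext ?_ ?_
      · simp [hsu]
      · simp [hsu]
    norm_map' f := by
      refine (sq_eq_sq₀ (norm_nonneg _) (norm_nonneg _)).1 ?_
      exact (Amplify.hasSum_norm_sq _).unique (key σ τ s t f) }

/-- The exchange of the two summands of `M ⊕ M`. -/
def exchangeSides (M : Type w) [NormedAddCommGroup M] [InnerProductSpace ℂ M] :
    WithLp 2 (M × M) ≃ₗᵢ[ℂ] WithLp 2 (M × M) where
  toFun m := WithLp.toLp 2 (m.snd, m.fst)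
  invFun m := WithLp.toLp 2 (m.snd, m.fst)
  map_add' _ _ := rfl
  map_smul' _ _ := rfl
  left_inv _ := rfl
  right_inv _ := rfl
  norm_map' m := by
    refine (sq_eq_sq₀ (norm_nonneg _) (norm_nonneg _)).1 ?_
    change ‖WithLp.toLp 2 (m.snd, m.fst)‖ ^ 2 = _
    rw [WithLp.prod_norm_sq_eq_of_L2, WithLp.prod_norm_sq_eq_of_L2]
    exact add_comm _ _

/-- The exchange of the `|1⟩`-components of the two summands of `(A ⊗ W) ⊕ (A ⊗ W)`. -/
def exchangeOnes (W : Type w) [NormedAddCommGroup W] [InnerProductSpace ℂ W] :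
    WithLp 2 (QubitTensor W × QubitTensor W) ≃ₗᵢ[ℂ] WithLp 2 (QubitTensor W × QubitTensor W) where
  toFun m := WithLp.toLp 2 (WithLp.toLp 2 ![m.fst 0, m.snd 1], WithLp.toLp 2 ![m.snd 0, m.fst 1])
  invFun m := WithLp.toLp 2 (WithLp.toLp 2 ![m.fst 0, m.snd 1], WithLp.toLp 2 ![m.snd 0, m.fst 1])
  map_add' m n := by
    apply (WithLp.equiv 2 _).injective
    ext i <;> fin_cases i <;> rfl
  map_smul' c m := by
    apply (WithLp.equiv 2 _).injective
    ext i <;> fin_cases i <;> rfl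
  left_inv m := by
    apply (WithLp.equiv 2 _).injective
    ext i <;> fin_cases i <;> rfl
  right_inv m := by
    apply (WithLp.equiv 2 _).injective
    ext i <;> fin_cases i <;> rfl
  norm_map' m := by
    refine (sq_eq_sq₀ (norm_nonneg _) (norm_nonneg _)).1 ?_
    change ‖WithLp.toLp 2 (_, _)‖ ^ 2 = _
    simp only [WithLp.prod_norm_sq_eq_of_L2, PiLp.norm_sq_eq_of_L2, Fin.sum_univ_two]
    simp
    ring

theorem exchangeOnes_toLp {W : Type w} [NormedAddCommGroup W] [InnerProductSpace ℂ W]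
    (a b c d : W) :
    exchangeOnes W (WithLp.toLp 2 (ketTensor 0 a + ketTensor 1 b, ketTensor 0 c + ketTensor 1 d)) =
      WithLp.toLp 2 (ketTensor 0 a + ketTensor 1 d, ketTensor 0 c + ketTensor 1 b) := by
  apply (WithLp.equiv 2 _).injective
  ext i <;> fin_cases i <;> simp [exchangeOnes, ketTensor]

/-! ### The interaction steps of the purifier -/

/-- The labels of the catalyst: two lines. -/
abbrev TwoLines : Type := ℤ ⊕ ℤ

/-- The involution that exchanges the nonnegative halves of the two lines. -/
def mirrorPerm : Equiv.Perm TwoLines where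
  toFun := Sum.elim (fun j => if 0 ≤ j then .inr j else .inl j)
    (fun j => if 0 ≤ j then .inl j else .inr j)
  invFun := Sum.elim (fun j => if 0 ≤ j then .inr j else .inl j)
    (fun j => if 0 ≤ j then .inl j else .inr j)
  left_inv := by rintro (j | j) <;> by_cases h : 0 ≤ j <;> simp [h]
  right_inv := by rintro (j | j) <;> by_cases h : 0 ≤ j <;> simp [h]

/-- The signs that accompany `mirrorPerm`. -/
def mirrorSign : TwoLines → ℤˣ := Sum.elim (fun _ => 1) (fun j => if 0 ≤ j then -1 else 1)

/-- The involution that exchanges the two lines with a shift by one. -/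
def crossPerm : Equiv.Perm TwoLines where
  toFun := Sum.elim (fun j => .inr (j + 1)) (fun j => .inl (j - 1))
  invFun := Sum.elim (fun j => .inr (j + 1)) (fun j => .inl (j - 1))
  left_inv := by rintro (j | j) <;> simp
  right_inv := by rintro (j | j) <;> simp

/-- The signs that accompany `crossPerm`. -/
def crossSign : TwoLines → ℤˣ := Sum.elim (fun _ => -1) (fun _ => 1)

/-- The shift of the second line. -/
def shiftRight : Equiv.Perm TwoLines := Equiv.sumCongr (Equiv.refl ℤ) (Equiv.addRight 1)

/-- The shift of the first line. -/
def shiftLeft : Equiv.Perm TwoLines := Equiv.sumCongr (Equiv.subRight 1) (Equiv.refl ℤ)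

theorem norm_ketTensor {W : Type u} [NormedAddCommGroup W] (b : Fin 2) (x : W) :
    ‖ketTensor b x‖ = ‖x‖ := by
  simp [ketTensor]

theorem ketTensor_zero {W : Type u} [NormedAddCommGroup W] (b : Fin 2) :
    ketTensor b (0 : W) = 0 := by
  simp [ketTensor]

/-- The query register `M = (A ⊗ W) ⊕ (A ⊗ W)` of the purifier. -/
abbrev QueryRegister (W : Type u) [NormedAddCommGroup W] : Type u :=
  WithLp 2 (QubitTensor W × QubitTensor W)

/-- The private space of the purifier. -/
abbrev PurifierSpace (W : Type u) [NormedAddCommGroup W] : Type u :=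
  Amplify TwoLines (QueryRegister W)

theorem units_smul_ketTensor {W : Type u} [NormedAddCommGroup W] (s : ℤˣ) (b : Fin 2) (x : W) :
    s • ketTensor b x = ketTensor b (s • x) := by
  rcases Int.units_eq_one_or s with rfl | rfl
  · rw [one_smul, one_smul]
  · ext i
    fin_cases b <;> fin_cases i <;> simp [ketTensor]

/-- The vector `|0⟩ ⊗ w₀` in the first summand of the query register. -/
def startFst {W : Type u} [NormedAddCommGroup W] (w₀ : W) : QueryRegister W := WithLp.toLp 2 (ketTensor 0 w₀, 0)

/-- The vector `|0⟩ ⊗ w₀` in the second summand of the query register. -/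
def startSnd {W : Type u} [NormedAddCommGroup W] (w₀ : W) : QueryRegister W := WithLp.toLp 2 (0, ketTensor 0 w₀)

theorem norm_startFst {W : Type u} [NormedAddCommGroup W] (w₀ : W) :
    ‖startFst w₀‖ = ‖w₀‖ := by
  rw [startFst, WithLp.norm_toLp_fst, norm_ketTensor]

theorem norm_startSnd {W : Type u} [NormedAddCommGroup W] (w₀ : W) :
    ‖startSnd w₀‖ = ‖w₀‖ := by
  rw [startSnd, WithLp.norm_toLp_snd, norm_ketTensor]

section steps

variable {W : Type u} [NormedAddCommGroup W] [InnerProductSpace ℂ W]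

/-- The unitary between the two queries. -/
def betweenQueries (W : Type u) [NormedAddCommGroup W] [InnerProductSpace ℂ W] :
    PurifierSpace W ≃ₗᵢ[ℂ] PurifierSpace W :=
  (idTensor TwoLines (exchangeOnes W)).trans <|
    (signedPermPair mirrorPerm crossPerm mirrorSign crossSign).trans <|
      (idTensor TwoLines (exchangeSides (QubitTensor W))).trans <|
        idTensor TwoLines (exchangeOnes W)

/-- The unitary after the second query, on the private space. -/
def afterQueries (w₀ : W) : PurifierSpace W ≃ₗᵢ[ℂ] PurifierSpace W :=
  (idTensor TwoLines (exchange (startFst w₀) (startSnd w₀))).trans <|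
    (signedPermPair shiftRight shiftLeft (fun _ => 1) (fun _ => -1)).trans <|
      (idTensor TwoLines (exchangeSides (QubitTensor W))).trans <|
        idTensor TwoLines (exchange (startFst w₀) (startSnd w₀))

theorem ketTensor_smul (c : ℂ) (b : Fin 2) (x : W) :
    ketTensor b (c • x) = c • ketTensor b x := by
  ext i
  fin_cases b <;> fin_cases i <;> simp [ketTensor]

/-- `exchangeOnes` sorts the two qubit values into different summands, so the two label permutations
act on them independently. The remaining exchanges reunite them in the second summand, where the
next query applies `O*`. -/
theorem betweenQueries_apply (Φ : PurifierSpace W) (a b : TwoLines → W)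
    (h : ∀ k, Φ k = WithLp.toLp 2 (ketTensor 0 (a k) + ketTensor 1 (b k), 0)) (k : TwoLines) :
    betweenQueries W Φ k = WithLp.toLp 2 (0, ketTensor 0 (mirrorSign k • a (mirrorPerm k)) +
      ketTensor 1 (crossSign k • b (crossPerm k))) := by
  have h1 (k : TwoLines) : exchangeOnes W (Φ k) =
      WithLp.toLp 2 (ketTensor 0 (a k), ketTensor 1 (b k)) := by
    have := exchangeOnes_toLp (a k) (b k) (0 : W) 0
    simp only [ketTensor_zero, add_zero, zero_add] at this
    rw [h, this]
  have h2 := exchangeOnes_toLp (0 : W) (crossSign k • b (crossPerm k))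
    (mirrorSign k • a (mirrorPerm k)) 0
  simp only [ketTensor_zero, add_zero, zero_add] at h2
  change exchangeOnes W (WithLp.toLp 2
    (crossSign k • (exchangeOnes W (Φ (crossPerm k))).snd,
      mirrorSign k • (exchangeOnes W (Φ (mirrorPerm k))).fst)) = _
  rw [h1, h1, ← h2]
  exact congrArg₂ (fun y z => exchangeOnes W (WithLp.toLp 2 (y, z)))
    (units_smul_ketTensor _ _ _) (units_smul_ketTensor _ _ _)

theorem inner_startFst_startSnd (w₀ : W) : inner ℂ (startFst w₀) (startSnd w₀) = 0 := by
  simp [startFst, startSnd]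

/-- The exchange of `startFst w₀` and `startSnd w₀` moves only the `|0⟩w₀` component and fixes `d`,
which is orthogonal to it. This separates the two components without knowledge of `d`. After the
shifts, everything is brought back to the first summand, ready for a query to `O`. -/
theorem afterQueries_apply {w₀ : W} (hw : ‖w₀‖ = 1) {d : QubitTensor W}
    (hd : inner ℂ (ketTensor 0 w₀) d = 0) (Φ : PurifierSpace W) (f g : TwoLines → ℂ)
    (h : ∀ k, Φ k = WithLp.toLp 2 (0, f k • ketTensor 0 w₀ + g k • d)) (k : TwoLines) :
    afterQueries w₀ Φ k = WithLp.toLp 2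
      (f (shiftRight k) • ketTensor 0 w₀ - g (shiftLeft k) • d, 0) := by
  have hF := (norm_startFst w₀).trans hw
  have hS := (norm_startSnd w₀).trans hw
  have hFS := inner_startFst_startSnd w₀
  have hl (a b : ℂ) : exchange (startFst w₀) (startSnd w₀)
      (WithLp.toLp 2 (0, a • ketTensor 0 w₀ + b • d)) =
        WithLp.toLp 2 (a • ketTensor 0 w₀, b • d) := by
    have e : WithLp.toLp 2 ((0 : QubitTensor W), a • ketTensor 0 w₀ + b • d) =
        a • startSnd w₀ + b • WithLp.toLp 2 (0, d) :=
      withLp_prod_ext (by simp [startSnd]) (by simp [startSnd])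
    rw [e, map_add, map_smul, map_smul, exchange_right hF hS hFS, exchange_of_orthogonal]
    · exact withLp_prod_ext (by simp [startFst]) (by simp [startFst])
    · simp [startFst]
    · simp [startSnd, hd]
  have hr (a b : ℂ) : exchange (startFst w₀) (startSnd w₀)
      (WithLp.toLp 2 (-(b • d), a • ketTensor 0 w₀)) =
        WithLp.toLp 2 (a • ketTensor 0 w₀ - b • d, 0) := by
    have e : WithLp.toLp 2 (-(b • d), a • ketTensor 0 w₀) =
        a • startSnd w₀ - b • WithLp.toLp 2 (d, 0) :=
      withLp_prod_ext (by simp [startSnd]) (by simp [startSnd])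
    rw [e, map_sub, map_smul, map_smul, exchange_right hF hS hFS, exchange_of_orthogonal]
    · exact withLp_prod_ext (by simp [startFst]) (by simp [startFst])
    · simp [startFst, hd]
    · simp [startSnd]
  change exchange (startFst w₀) (startSnd w₀) (WithLp.toLp 2
    ((-1 : ℤˣ) • (exchange (startFst w₀) (startSnd w₀) (Φ (shiftLeft k))).snd,
      (1 : ℤˣ) • (exchange (startFst w₀) (startSnd w₀) (Φ (shiftRight k))).fst)) = _
  rw [h, h, hl, hl, ← hr]
  refine congrArg (exchange (startFst w₀) (startSnd w₀)) (withLp_prod_ext ?_ ?_)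
  · change (-1 : ℤˣ) • (g (shiftLeft k) • d) = -(g (shiftLeft k) • d)
    rw [Units.neg_smul, one_smul]
  · exact one_smul _ _

/-- The image of a catalyst under both queries and the unitaries on the private space: the
coefficients on `|0⟩|0⟩` and on the orthogonal vector that the oracle maps into the span of
`|0⟩φ₀` and `|1⟩φ₁` change as in a two-dimensional rotation followed by signed permutations. -/
theorem purifier_step {w₀ φ₀ φ₁ : W} (hw : ‖w₀‖ = 1)
    {O : QubitTensor W ≃ₗᵢ[ℂ] QubitTensor W} {x y : ℝ} {d : QubitTensor W}
    (hO : O (ketTensor 0 w₀) = (x : ℂ) • ketTensor 0 φ₀ + (y : ℂ) • ketTensor 1 φ₁)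
    (hd : O d = (y : ℂ) • ketTensor 0 φ₀ - (x : ℂ) • ketTensor 1 φ₁)
    (hwd : inner ℂ (ketTensor 0 w₀) d = 0)
    {f g f' g' : TwoLines → ℝ}
    (h₀ : ∀ k, x * f' k + y * g' k =
      ((mirrorSign k : ℤ) : ℝ) * (x * f (mirrorPerm k) + y * g (mirrorPerm k)))
    (h₁ : ∀ k, y * f' k - x * g' k =
      ((crossSign k : ℤ) : ℝ) * (y * f (crossPerm k) - x * g (crossPerm k)))
    (Φ : PurifierSpace W)
    (hΦ : ∀ k, Φ k = WithLp.toLp 2 ((f k : ℂ) • ketTensor 0 w₀ + (g k : ℂ) • d, 0))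
    (k : TwoLines) :
    afterQueries w₀ (idTensor TwoLines (bidirectional O)
      (betweenQueries W (idTensor TwoLines (bidirectional O) Φ))) k =
    WithLp.toLp 2 ((f' (shiftRight k) : ℂ) • ketTensor 0 w₀ - (g' (shiftLeft k) : ℂ) • d, 0) := by
  have hunits (s : ℤˣ) (c : ℝ) (z : W) :
      s • (c : ℂ) • z = ((((s : ℤ) : ℝ) * c : ℝ) : ℂ) • z := by
    rcases Int.units_eq_one_or s with rfl | rfl <;> simp
  refine afterQueries_apply hw hwd _ (fun k => (f' k : ℂ)) (fun k => (g' k : ℂ)) (fun k => ?_) k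
  have hfirst (k : TwoLines) : idTensor TwoLines (bidirectional O) Φ k = WithLp.toLp 2
      (ketTensor 0 (((x * f k + y * g k : ℝ) : ℂ) • φ₀) +
        ketTensor 1 (((y * f k - x * g k : ℝ) : ℂ) • φ₁), 0) := by
    rw [idTensor_apply, hΦ]
    refine withLp_prod_ext ?_ ?_
    · change O ((f k : ℂ) • ketTensor 0 w₀ + (g k : ℂ) • d) = ketTensor 0 _ + ketTensor 1 _
      rw [map_add, map_smul, map_smul, hO, hd]
      simp only [ketTensor_smul]
      push_cast
      module
    · change O.symm 0 = 0
      exact map_zero _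
  rw [idTensor_apply, betweenQueries_apply _ _ _ hfirst]
  refine withLp_prod_ext ?_ ?_
  · change O 0 = 0
    exact map_zero _
  · change O.symm (ketTensor 0 _ + ketTensor 1 _) =
      (f' k : ℂ) • ketTensor 0 w₀ + (g' k : ℂ) • d
    -- Instead of inverting `O`, compare images under `O`: `h₀` and `h₁` are the equalities of
    -- coefficients at `|0⟩φ₀` and `|1⟩φ₁`.
    rw [LinearIsometryEquiv.symm_apply_eq, map_add, map_smul, map_smul, hO, hd, hunits, hunits,
      ← h₀, ← h₁]
    simp only [ketTensor_smul]
    push_cast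
    module

end steps

/-! ### The purifier -/

section purifier

variable {W : Type u} [NormedAddCommGroup W] [InnerProductSpace ℂ W]

/-- The public basis state `|b⟩` in the space of the purifier. -/
def publicKet (W : Type u) [NormedAddCommGroup W] (b : Fin 2) :
    WithLp 2 (Qubit × PurifierSpace W) :=
  WithLp.toLp 2 (ket b, 0)

/-- The label of the private state where the public state `|b⟩` enters or leaves. -/
def port (b : Fin 2) : TwoLines := if b = 0 then .inl (-1) else .inr (-1)

/-- The private state with which the public state `|b⟩` is exchanged. -/
def portState {W : Type u} [NormedAddCommGroup W] (w₀ : W) (b : Fin 2) : PurifierSpace W := lp.single 2 (port b) (startFst w₀)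

/-- The exchange of the public state `|b⟩` with the private state at its port. -/
def portExchange (w₀ : W) (b : Fin 2) :
    WithLp 2 (Qubit × PurifierSpace W) ≃ₗᵢ[ℂ] WithLp 2 (Qubit × PurifierSpace W) :=
  exchange (publicKet W b) (WithLp.toLp 2 (0, portState w₀ b))

/-- A unitary on the private space, extended by the identity to the public space. -/
def privately (V : PurifierSpace W ≃ₗᵢ[ℂ] PurifierSpace W) :
    WithLp 2 (Qubit × PurifierSpace W) ≃ₗᵢ[ℂ] WithLp 2 (Qubit × PurifierSpace W) :=
  LinearIsometryEquiv.withLpProdCongr 2 (LinearIsometryEquiv.refl ℂ Qubit) V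

theorem privately_apply (V : PurifierSpace W ≃ₗᵢ[ℂ] PurifierSpace W) (h : Qubit)
    (c : PurifierSpace W) : privately V (WithLp.toLp 2 (h, c)) = WithLp.toLp 2 (h, V c) := rfl

theorem toLp_zero_add {E : Type v} {F : Type w} [AddCommGroup E] [AddCommGroup F] (c d : F) :
    WithLp.toLp 2 ((0 : E), c + d) = WithLp.toLp 2 (0, c) + WithLp.toLp 2 (0, d) :=
  withLp_prod_ext (by simp) (by simp)

/-- The input-independent unitaries of the purifier. -/
def purifierUnitary (w₀ : W) :
    ℕ → (WithLp 2 (Qubit × PurifierSpace W) ≃ₗᵢ[ℂ] WithLp 2 (Qubit × PurifierSpace W))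
  | 0 => portExchange w₀ 0
  | 1 => privately (betweenQueries W)
  | _ + 2 => ((privately (afterQueries w₀)).trans (portExchange w₀ 0)).trans (portExchange w₀ 1)

/-- The purifier. -/
def purifier (w₀ : W) : Transducer.{u, 0, u} (QueryRegister W) Qubit (PurifierSpace W) where
  impl :=
    -- The work part is only the public qubit, lifted to the required universe; the query part is
    -- the whole private space.
    { Work := EuclideanSpace ℂ (ULift.{u} (Fin 2))
      Idx := TwoLines
      decomp := LinearIsometryEquiv.withLpProdCongr 2
        (LinearIsometryEquiv.piLpCongrLeft 2 ℂ ℂ Equiv.ulift.symm)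
        (LinearIsometryEquiv.refl ℂ (PurifierSpace W))
      numQueries := 2
      U := purifierUnitary w₀ }

theorem purifier_queryOperator (w₀ : W) (O : QueryRegister W ≃ₗᵢ[ℂ] QueryRegister W) :
    (purifier w₀).impl.queryOperator O = privately (idTensor TwoLines O) := by
  refine LinearIsometryEquiv.ext fun z => withLp_prod_ext ?_ rfl
  exact (LinearIsometryEquiv.piLpCongrLeft 2 ℂ ℂ Equiv.ulift.{u}.symm).symm_apply_apply z.fst

theorem norm_ket (b : Fin 2) : ‖ket b‖ = 1 := by simp [ket]

theorem norm_publicKet {W : Type u} [NormedAddCommGroup W] (b : Fin 2) : ‖publicKet W b‖ = 1 := by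
  rw [publicKet, WithLp.norm_toLp_fst, norm_ket]

theorem norm_portState {W : Type u} [NormedAddCommGroup W] {w₀ : W} (hw : ‖w₀‖ = 1) (b : Fin 2) : ‖portState w₀ b‖ = 1 := by
  rw [portState, lp.norm_single (by norm_num), norm_startFst, hw]

theorem inner_portState_left (w₀ : W) (b : Fin 2) (c : PurifierSpace W) :
    inner ℂ (portState w₀ b) c = inner ℂ (startFst w₀) (c (port b)) :=
  lp.inner_single_left _ _ _

theorem portExchange_publicKet {w₀ : W} (hw : ‖w₀‖ = 1) (b : Fin 2) :
    portExchange w₀ b (publicKet W b) = WithLp.toLp 2 (0, portState w₀ b) := by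
  refine exchange_left (norm_publicKet b) ?_ ?_
  · rw [WithLp.norm_toLp_snd, norm_portState hw]
  · simp [publicKet]

theorem portExchange_portState {w₀ : W} (hw : ‖w₀‖ = 1) (b : Fin 2) :
    portExchange w₀ b (WithLp.toLp 2 (0, portState w₀ b)) = publicKet W b := by
  refine exchange_right (norm_publicKet b) ?_ ?_
  · rw [WithLp.norm_toLp_snd, norm_portState hw]
  · simp [publicKet]

theorem portExchange_private {w₀ : W} {b : Fin 2} {c : PurifierSpace W} (hc : c (port b) = 0) :
    portExchange w₀ b (WithLp.toLp 2 (0, c)) = WithLp.toLp 2 (0, c) := by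
  refine exchange_of_orthogonal ?_ ?_
  · simp [publicKet]
  · rw [WithLp.prod_inner_apply]
    change inner ℂ (0 : Qubit) 0 + inner ℂ (portState w₀ b) c = 0
    rw [inner_portState_left, hc, inner_zero_right, inner_zero_right, add_zero]

theorem portExchange_publicKet_of_ne {w₀ : W} {b b' : Fin 2} (h : b ≠ b') :
    portExchange w₀ b (publicKet W b') = publicKet W b' := by
  refine exchange_of_orthogonal ?_ ?_
  · simp [publicKet, ket, EuclideanSpace.inner_single_left, h]
  · simp [publicKet]

theorem toLp_ket {W : Type u} [NormedAddCommGroup W] (b : Fin 2) (c : PurifierSpace W) :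
    WithLp.toLp 2 (ket b, c) = publicKet W b + WithLp.toLp 2 (0, c) :=
  withLp_prod_ext (by simp [publicKet]) (by simp [publicKet])

/-- No public amplitude remains at the first query. As `c` vanishes at the port, the exchange
affects only the public `|0⟩`. -/
theorem purifier_evolve_zero {w₀ : W} (hw : ‖w₀‖ = 1) (O : QueryRegister W ≃ₗᵢ[ℂ] QueryRegister W)
    {c : PurifierSpace W} (hc : c (port 0) = 0) :
    (purifier w₀).impl.evolve O 0 (WithLp.toLp 2 (ket 0, c)) =
      WithLp.toLp 2 (0, portState w₀ 0 + c) := by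
  change portExchange w₀ 0 _ = _
  rw [toLp_ket, map_add, portExchange_publicKet hw, portExchange_private hc]
  exact withLp_prod_ext (by simp) (by simp)

theorem purifier_evolve_one {w₀ : W} (hw : ‖w₀‖ = 1) (O : QueryRegister W ≃ₗᵢ[ℂ] QueryRegister W)
    {c : PurifierSpace W} (hc : c (port 0) = 0) :
    (purifier w₀).impl.evolve O 1 (WithLp.toLp 2 (ket 0, c)) =
      WithLp.toLp 2 (0, betweenQueries W (idTensor TwoLines O (portState w₀ 0 + c))) := by
  change privately (betweenQueries W) ((purifier w₀).impl.queryOperator O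
    ((purifier w₀).impl.evolve O 0 _)) = _
  rw [purifier_evolve_zero hw O hc, purifier_queryOperator]
  rfl

/-- Since `c` vanishes at both ports, the final exchanges leave it alone and only turn the port
state of `b` into the public `|b⟩`. -/
theorem purifier_transduces {w₀ : W} (hw : ‖w₀‖ = 1) (O : QueryRegister W ≃ₗᵢ[ℂ] QueryRegister W)
    {c : PurifierSpace W} (hc : ∀ b, c (port b) = 0) (b : Fin 2)
    (h : afterQueries w₀ (idTensor TwoLines O
      (betweenQueries W (idTensor TwoLines O (portState w₀ 0 + c)))) = portState w₀ b + c) :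
    (purifier w₀).Transduces O (ket 0) (ket b) c := by
  change portExchange w₀ 1 (portExchange w₀ 0 (privately (afterQueries w₀)
    ((purifier w₀).impl.queryOperator O ((purifier w₀).impl.evolve O 1 _)))) = _
  have hne : portState w₀ 1 (port 0) = 0 := by
    rw [portState, lp.single_apply_ne]
    decide
  rw [purifier_evolve_one hw O (hc 0), purifier_queryOperator, privately_apply,
    privately_apply, h, toLp_zero_add, map_add, map_add, portExchange_private (hc 0),
    portExchange_private (hc 1), toLp_ket]
  fin_cases b
  · simp only [Fin.zero_eta, Fin.isValue]
    rw [portExchange_portState hw, portExchange_publicKet_of_ne one_ne_zero]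
  · simp only [Fin.mk_one, Fin.isValue]
    rw [portExchange_private hne, portExchange_portState hw]

theorem norm_portState_add_sq {w₀ : W} (hw : ‖w₀‖ = 1) {c : PurifierSpace W}
    (hc : c (port 0) = 0) : ‖portState w₀ 0 + c‖ ^ 2 = 1 + ‖c‖ ^ 2 := by
  have := norm_add_sq_eq_norm_sq_add_norm_sq_of_inner_eq_zero (𝕜 := ℂ) (portState w₀ 0) c
    (by rw [inner_portState_left, hc, inner_zero_right])
  rw [sq, this, norm_portState hw]
  ring

/-- Both queries see the full state, whose squared norm `1 + ‖c‖²` is preserved by everything in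
between. -/
theorem purifier_queryComplexity {w₀ : W} (hw : ‖w₀‖ = 1)
    (O : QueryRegister W ≃ₗᵢ[ℂ] QueryRegister W) {c : PurifierSpace W} (hc : c (port 0) = 0) :
    (purifier w₀).queryComplexity O (ket 0) c = 2 * (1 + ‖c‖ ^ 2) := by
  have h0 : (purifier w₀).impl.queryState O (WithLp.toLp 2 (ket 0, c)) 0 =
      portState w₀ 0 + c :=
    congrArg WithLp.snd (purifier_evolve_zero hw O hc)
  have h1 : (purifier w₀).impl.queryState O (WithLp.toLp 2 (ket 0, c)) 1 =
      betweenQueries W (idTensor TwoLines O (portState w₀ 0 + c)) :=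
    congrArg WithLp.snd (purifier_evolve_one hw O hc)
  calc (purifier w₀).queryComplexity O (ket 0) c
      = ‖portState w₀ 0 + c‖ ^ 2 +
        ‖betweenQueries W (idTensor TwoLines O (portState w₀ 0 + c))‖ ^ 2 := by
        rw [← h1, ← h0]
        exact (Finset.sum_range_succ (fun t => ‖(purifier w₀).impl.queryState O
          (WithLp.toLp 2 (ket 0, c)) t‖ ^ 2) 1).trans (by rw [Finset.sum_range_one]; rfl)
    _ = 2 * (1 + ‖c‖ ^ 2) := by
        rw [LinearIsometryEquiv.norm_map, LinearIsometryEquiv.norm_map,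
          norm_portState_add_sq hw hc]
        ring

theorem purifierSpace_infinite {w₀ : W} (hw : ‖w₀‖ = 1) :
    ¬ FiniteDimensional ℂ (PurifierSpace W) := by
  intro hfin
  have ho : Orthonormal ℂ fun k : TwoLines =>
      (lp.single 2 k (startFst w₀) : PurifierSpace W) := by
    refine ⟨fun k => ?_, fun k l hkl => ?_⟩
    · rw [lp.norm_single (by norm_num), norm_startFst, hw]
    · change inner ℂ (lp.single 2 k (startFst w₀) : PurifierSpace W)
        (lp.single 2 l (startFst w₀)) = 0
      rw [lp.inner_single_left, lp.single_apply_ne _ _ _ hkl, inner_zero_right]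
  have := ho.linearIndependent.finite
  exact not_finite TwoLines

end purifier

/-! ### From coefficient recurrences to catalysts -/

section catalyst

variable {W : Type u} [NormedAddCommGroup W] [InnerProductSpace ℂ W]

theorem inner_ketTensor_zero_one (a b : W) :
    inner ℂ (ketTensor 0 a) (ketTensor 1 b) = 0 := by
  simp [ketTensor, PiLp.inner_apply]

/-- The coefficient vector `(y, -x)` is a unit vector orthogonal to `(x, y)`, and `O` is unitary.
The result depends on `O`, which is harmless because only the catalyst involves it. -/
theorem exists_orthogonal_preimage {w₀ φ₀ φ₁ : W} (h₀ : ‖φ₀‖ = 1) (h₁ : ‖φ₁‖ = 1)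
    {O : QubitTensor W ≃ₗᵢ[ℂ] QubitTensor W} {x y : ℝ} (hxy : x ^ 2 + y ^ 2 = 1)
    (hO : O (ketTensor 0 w₀) = (x : ℂ) • ketTensor 0 φ₀ + (y : ℂ) • ketTensor 1 φ₁) :
    ∃ d, O d = (y : ℂ) • ketTensor 0 φ₀ - (x : ℂ) • ketTensor 1 φ₁ ∧ ‖d‖ = 1 ∧
      inner ℂ (ketTensor 0 w₀) d = 0 := by
  have h01 := inner_ketTensor_zero_one φ₀ φ₁
  have h10 := inner_eq_zero_symm.1 h01
  have hn0 : ‖ketTensor 0 φ₀‖ = 1 := (norm_ketTensor 0 φ₀).trans h₀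
  have hn1 : ‖ketTensor 1 φ₁‖ = 1 := (norm_ketTensor 1 φ₁).trans h₁
  refine ⟨O.symm ((y : ℂ) • ketTensor 0 φ₀ - (x : ℂ) • ketTensor 1 φ₁),
    O.apply_symm_apply _, ?_, ?_⟩
  · rw [O.symm.norm_map]
    refine (sq_eq_sq₀ (norm_nonneg _) zero_le_one).1 ?_
    rw [sq, sub_eq_add_neg, norm_add_sq_eq_norm_sq_add_norm_sq_of_inner_eq_zero (𝕜 := ℂ),
      norm_neg, norm_smul, norm_smul, hn0, hn1, Complex.norm_real, Complex.norm_real]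
    · simp only [Real.norm_eq_abs, mul_one, abs_mul_abs_self]
      linarith
    · rw [inner_neg_right, inner_smul_left, inner_smul_right, h01, mul_zero, mul_zero, neg_zero]
  · rw [← O.inner_map_map, O.apply_symm_apply, hO]
    simp only [inner_add_left, inner_sub_right, inner_smul_left, inner_smul_right, h01, h10,
      inner_self_eq_norm_sq_to_K, hn0, hn1, Complex.conj_ofReal]
    push_cast
    ring

/-- A family of coefficients that the queries and the private unitaries of the purifier reproduce,
up to moving the amplitude `1` from the port of `|0⟩` to the port of `|b⟩`, yields a catalyst. -/
theorem exists_catalyst {w₀ φ₀ φ₁ : W} (hw : ‖w₀‖ = 1) (hφ₀ : ‖φ₀‖ = 1) (hφ₁ : ‖φ₁‖ = 1)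
    {O : QubitTensor W ≃ₗᵢ[ℂ] QubitTensor W} {x y : ℝ} (hxy : x ^ 2 + y ^ 2 = 1)
    (hO : O (ketTensor 0 w₀) = (x : ℂ) • ketTensor 0 φ₀ + (y : ℂ) • ketTensor 1 φ₁)
    {f g f' g' : TwoLines → ℝ} {T : ℝ} (b : Fin 2)
    (hsum : HasSum (fun k => f k ^ 2 + g k ^ 2) T)
    (hf0 : f (port 0) = 1) (hf1 : f (port 1) = 0) (hg : ∀ b, g (port b) = 0)
    (h₀ : ∀ k, x * f' k + y * g' k =
      ((mirrorSign k : ℤ) : ℝ) * (x * f (mirrorPerm k) + y * g (mirrorPerm k)))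
    (h₁ : ∀ k, y * f' k - x * g' k =
      ((crossSign k : ℤ) : ℝ) * (y * f (crossPerm k) - x * g (crossPerm k)))
    (hf' : ∀ k, f' (shiftRight k) =
      f k - (if k = port 0 then 1 else 0) + (if k = port b then 1 else 0))
    (hg' : ∀ k, g' (shiftLeft k) = -g k) :
    ∃ c : PurifierSpace W,
      (purifier w₀).Transduces (bidirectional O) (ket 0) (ket b) c ∧
      (purifier w₀).queryComplexity (bidirectional O) (ket 0) c = 2 * T ∧ ‖c‖ ^ 2 = T - 1 := by
  obtain ⟨d, hd, hdn, hwd⟩ := exists_orthogonal_preimage hφ₀ hφ₁ hxy hO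
  have hnorm (k : TwoLines) :
      ‖(WithLp.toLp 2 ((f k : ℂ) • ketTensor 0 w₀ + (g k : ℂ) • d, 0) : QueryRegister W)‖ ^ 2 =
        f k ^ 2 + g k ^ 2 := by
    rw [WithLp.norm_toLp_fst, sq,
      norm_add_sq_eq_norm_sq_add_norm_sq_of_inner_eq_zero (𝕜 := ℂ), norm_smul, norm_smul,
      norm_ketTensor, hw, hdn, Complex.norm_real, Complex.norm_real]
    · simp only [Real.norm_eq_abs, mul_one, abs_mul_abs_self]
      ring
    · rw [inner_smul_left, inner_smul_right, hwd, mul_zero, mul_zero]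
  rw [← funext hnorm] at hsum
  -- `Φ` is the full state at the first query; the catalyst is what remains after removing the
  -- injected port state.
  let Φ : PurifierSpace W :=
    ⟨fun k => WithLp.toLp 2 ((f k : ℂ) • ketTensor 0 w₀ + (g k : ℂ) • d, 0),
      memℓp_two_of_summable hsum.summable⟩
  have hΦ (k : TwoLines) :
      Φ k = WithLp.toLp 2 ((f k : ℂ) • ketTensor 0 w₀ + (g k : ℂ) • d, 0) := rfl
  have hΦn : ‖Φ‖ ^ 2 = T := (Amplify.hasSum_norm_sq Φ).unique hsum
  have hport (b : Fin 2) (k : TwoLines) : portState w₀ b k =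
      WithLp.toLp 2 ((if k = port b then (1 : ℂ) else 0) • ketTensor 0 w₀, 0) := by
    rw [portState, lp.single_apply]
    by_cases h : k = port b
    · subst h
      rw [Pi.single_eq_same, if_pos rfl, one_smul, startFst]
    · rw [Pi.single_eq_of_ne h, if_neg h, zero_smul]
      rfl
  have hsub (k : TwoLines) : (Φ - portState w₀ 0) k = WithLp.toLp 2
      (((f k - if k = port 0 then 1 else 0 : ℝ) : ℂ) • ketTensor 0 w₀ + (g k : ℂ) • d, 0) := by
    change Φ k - portState w₀ 0 k = _
    rw [hΦ, hport]
    refine withLp_prod_ext ?_ (sub_zero _)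
    change (f k : ℂ) • ketTensor 0 w₀ + (g k : ℂ) • d -
      (if k = port 0 then (1 : ℂ) else 0) • ketTensor 0 w₀ = _
    split_ifs <;> (simp [sub_smul]; try abel)
  have hne : port 1 ≠ port 0 := by decide
  have hc (b : Fin 2) : (Φ - portState w₀ 0) (port b) = 0 := by
    rw [hsub]
    fin_cases b
    · simp [hf0, hg]
    · simp [hf1, hg, hne]
  have hadd : portState w₀ 0 + (Φ - portState w₀ 0) = Φ := by abel
  have hcn := norm_portState_add_sq hw (hc 0)
  rw [hadd, hΦn] at hcn
  refine ⟨Φ - portState w₀ 0, purifier_transduces hw _ hc b ?_, ?_, by linarith⟩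
  · rw [hadd]
    ext1
    funext k
    rw [purifier_step hw hO hd hwd h₀ h₁ Φ hΦ, hf', hg']
    change _ = portState w₀ b k + (Φ - portState w₀ 0) k
    rw [hsub, hport]
    refine withLp_prod_ext ?_ (add_zero _).symm
    change ((f k - (if k = port 0 then 1 else 0) + (if k = port b then 1 else 0) : ℝ) : ℂ) •
      ketTensor 0 w₀ - ((-g k : ℝ) : ℂ) • d = (if k = port b then (1 : ℂ) else 0) • ketTensor 0 w₀ +
      (((f k - if k = port 0 then 1 else 0 : ℝ) : ℂ) • ketTensor 0 w₀ + (g k : ℂ) • d)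
    rcases eq_or_ne k (port b) with hb | hb <;> simp only [hb, if_true, if_false] <;> push_cast <;>
      module
  · rw [purifier_queryComplexity hw _ (hc 0), ← hcn]

end catalyst

/-! ### Geometric catalysts -/

/-- The sequence `n ↦ r ^ n` on the nonnegative integers, extended by zero. -/
def halfGeom (r : ℝ) (n : ℤ) : ℝ := if 0 ≤ n then r ^ n.toNat else 0

theorem halfGeom_of_neg {r : ℝ} {n : ℤ} (h : n < 0) : halfGeom r n = 0 := if_neg (by omega)

theorem halfGeom_zero (r : ℝ) : halfGeom r 0 = 1 := by simp [halfGeom]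

theorem halfGeom_natCast (r : ℝ) (n : ℕ) : halfGeom r n = r ^ n := by simp [halfGeom]

theorem halfGeom_succ (r : ℝ) {n : ℤ} (h : 0 ≤ n) : halfGeom r (n + 1) = r * halfGeom r n := by
  lift n to ℕ using h
  rw [halfGeom_natCast, ← pow_succ']
  exact halfGeom_natCast r (n + 1)

theorem hasSum_of_forall_eq {ι : Type v} {f g : ι → ℝ} {a : ℝ} (h : HasSum f a)
    (e : ∀ i, g i = f i) : HasSum g a := by
  rwa [funext e]

theorem hasSum_halfGeom_odd {r : ℝ} (hr : r ^ 2 < 1) :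
    HasSum (fun j : ℤ => halfGeom r (2 * j + 1) ^ 2) (r ^ 2 / (1 - r ^ 4)) := by
  have h4 : r ^ 4 < 1 := by nlinarith [sq_nonneg r]
  have h := (hasSum_geometric_of_lt_one (by positivity) h4).mul_left (r ^ 2)
  rw [← div_eq_mul_inv] at h
  refine (Function.Injective.hasSum_iff (g := fun n : ℕ => (n : ℤ)) Nat.cast_injective ?_).1 ?_
  · intro j hj
    rw [halfGeom_of_neg, sq, zero_mul]
    by_contra h0
    exact hj ⟨j.toNat, by simp; omega⟩
  · refine hasSum_of_forall_eq h fun n => ?_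
    change halfGeom r ((2 * n + 1 : ℕ) : ℤ) ^ 2 = _
    rw [halfGeom_natCast]
    ring

theorem hasSum_halfGeom_even {r : ℝ} (hr : r ^ 2 < 1) :
    HasSum (fun j : ℤ => halfGeom r (2 * j + 2) ^ 2) (1 / (1 - r ^ 4)) := by
  have h4 : r ^ 4 < 1 := by nlinarith [sq_nonneg r]
  have h := hasSum_geometric_of_lt_one (by positivity) h4
  rw [← one_div] at h
  -- The even exponents start at `j = -1`, the label of the port, hence the shift in the reindexing.
  refine (Function.Injective.hasSum_iff (g := fun n : ℕ => (n : ℤ) - 1)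
    (fun m n hmn => by simpa using hmn) ?_).1 ?_
  · intro j hj
    rw [halfGeom_of_neg, sq, zero_mul]
    by_contra h0
    exact hj ⟨(j + 1).toNat, by simp; omega⟩
  · refine hasSum_of_forall_eq h fun n => ?_
    change halfGeom r (2 * ((n : ℤ) - 1) + 2) ^ 2 = _
    rw [show 2 * ((n : ℤ) - 1) + 2 = ((2 * n : ℕ) : ℤ) by push_cast; ring, halfGeom_natCast]
    ring

theorem geometric_split {r : ℝ} (hr : r ^ 2 < 1) :
    1 / (1 - r ^ 4) + r ^ 2 / (1 - r ^ 4) = 1 / (1 - r ^ 2) := by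
  have h4 : r ^ 4 < 1 := by nlinarith [sq_nonneg r]
  rw [← add_div, div_eq_div_iff (by linarith) (by linarith)]
  ring

/-! ### The catalysts on the two sides of `p = 1/2` -/

section

variable {x y r : ℝ}

/-- Even powers of `r` sit on the first line as multiples of `|0⟩w₀`, odd powers on the second as
multiples of `d`. The permutations match neighbouring powers, and `y = r * x` makes their amplitudes
agree. -/
theorem exists_catalyst_lt {W : Type u} [NormedAddCommGroup W] [InnerProductSpace ℂ W]
    {w₀ φ₀ φ₁ : W} (hw : ‖w₀‖ = 1) (hφ₀ : ‖φ₀‖ = 1) (hφ₁ : ‖φ₁‖ = 1)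
    {O : QubitTensor W ≃ₗᵢ[ℂ] QubitTensor W} (hxy : x ^ 2 + y ^ 2 = 1)
    (hO : O (ketTensor 0 w₀) = (x : ℂ) • ketTensor 0 φ₀ + (y : ℂ) • ketTensor 1 φ₁)
    (hy : y = r * x) (hr : r ^ 2 < 1) :
    ∃ c : PurifierSpace W,
      (purifier w₀).Transduces (bidirectional O) (ket 0) (ket 0) c ∧
      (purifier w₀).queryComplexity (bidirectional O) (ket 0) c = 2 * (1 / (1 - r ^ 2)) ∧
      ‖c‖ ^ 2 = 1 / (1 - r ^ 2) - 1 := by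
  subst hy
  refine exists_catalyst hw hφ₀ hφ₁ hxy hO
    (f := Sum.elim (fun j => halfGeom r (2 * j + 2)) (fun _ => 0))
    (g := Sum.elim (fun _ => 0) (fun j => halfGeom r (2 * j + 1)))
    -- The round up to `O*` only flips the sign of the `d` part, and the last sign restores it. The
    -- shifts do nothing, as each moves a line where the coefficient is zero.
    (f' := Sum.elim (fun j => halfGeom r (2 * j + 2)) (fun _ => 0))
    (g' := Sum.elim (fun _ => 0) (fun j => -halfGeom r (2 * j + 1)))
    0 ?_ ?_ ?_ ?_ ?_ ?_ ?_ ?_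
  · rw [← geometric_split hr]
    refine HasSum.sum ?_ ?_
    · simpa [Function.comp_def] using hasSum_halfGeom_even hr
    · simpa [Function.comp_def] using hasSum_halfGeom_odd hr
  · simp [port, halfGeom_zero]
  · simp [port]
  · intro b
    fin_cases b
    · simp [port]
    · simp [port, halfGeom_of_neg]
  · rintro (j | j) <;> by_cases h : 0 ≤ j
    · have := halfGeom_succ r (n := 2 * j + 1) (by omega)
      rw [add_assoc, one_add_one_eq_two] at this
      simp [mirrorSign, mirrorPerm, h, this]
      ring
    · simp [mirrorSign, mirrorPerm, h]
    · have := halfGeom_succ r (n := 2 * j + 1) (by omega)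
      rw [add_assoc, one_add_one_eq_two] at this
      simp [mirrorSign, mirrorPerm, h, this]
      ring
    · simp [mirrorSign, mirrorPerm, h, halfGeom_of_neg (show 2 * j + 1 < 0 by omega)]
  · rintro (j | j)
    · have e : 2 * (j + 1) + 1 = 2 * j + 2 + 1 := by ring
      by_cases h : 0 ≤ 2 * j + 2
      · have := halfGeom_succ r h
        simp [crossSign, crossPerm, e, this]
        ring
      · simp [crossSign, crossPerm, e, halfGeom_of_neg (show 2 * j + 2 < 0 by omega),
          halfGeom_of_neg (show 2 * j + 2 + 1 < 0 by omega)]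
    · have e : 2 * (j - 1) + 2 = 2 * j := by ring
      by_cases h : 0 ≤ 2 * j
      · have := halfGeom_succ r h
        simp [crossSign, crossPerm, e, this]
        ring
      · simp [crossSign, crossPerm, e, halfGeom_of_neg (show 2 * j < 0 by omega),
          halfGeom_of_neg (show 2 * j + 1 < 0 by omega)]
  · rintro (j | j) <;> simp [shiftRight]
  · rintro (j | j) <;> simp [shiftLeft]

/-- The roles of the lines are reversed: except for the incoming `1`, the even powers lie on the
second line and the odd ones, negated, on the first. The shifts now act nontrivially, and the term
`r ^ 0` arrives at the port of `|1⟩`. -/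
theorem exists_catalyst_gt {W : Type u} [NormedAddCommGroup W] [InnerProductSpace ℂ W]
    {w₀ φ₀ φ₁ : W} (hw : ‖w₀‖ = 1) (hφ₀ : ‖φ₀‖ = 1) (hφ₁ : ‖φ₁‖ = 1)
    {O : QubitTensor W ≃ₗᵢ[ℂ] QubitTensor W} (hxy : x ^ 2 + y ^ 2 = 1)
    (hO : O (ketTensor 0 w₀) = (x : ℂ) • ketTensor 0 φ₀ + (y : ℂ) • ketTensor 1 φ₁)
    (hx : x = r * y) (hr : r ^ 2 < 1) :
    ∃ c : PurifierSpace W,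
      (purifier w₀).Transduces (bidirectional O) (ket 0) (ket 1) c ∧
      (purifier w₀).queryComplexity (bidirectional O) (ket 0) c = 2 * (1 / (1 - r ^ 2)) ∧
      ‖c‖ ^ 2 = 1 / (1 - r ^ 2) - 1 := by
  subst hx
  refine exists_catalyst hw hφ₀ hφ₁ hxy hO
    (f := Sum.elim (fun j => if j = -1 then 1 else 0)
      -- The cutoff removes the value `1` at `j = -1`: port `1` must be empty at the first query.
      (fun j => if 0 ≤ j then halfGeom r (2 * j + 2) else 0))
    (g := Sum.elim (fun j => -halfGeom r (2 * j + 1)) (fun _ => 0))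
    (f' := Sum.elim (fun _ => 0) (fun j => halfGeom r (2 * j)))
    (g' := Sum.elim (fun j => halfGeom r (2 * j + 3)) (fun _ => 0))
    1 ?_ ?_ ?_ ?_ ?_ ?_ ?_ ?_
  · have h1 : HasSum (fun j : ℤ => if j = -1 then (1 : ℝ) else 0) 1 := hasSum_ite_eq (-1) 1
    -- The unit amplitude lies on the first line instead of continuing the even powers on the
    -- second, so one unit moves between the two sums.
    rw [← geometric_split hr, show 1 / (1 - r ^ 4) + r ^ 2 / (1 - r ^ 4) =
      (1 + r ^ 2 / (1 - r ^ 4)) + (1 / (1 - r ^ 4) - 1) by ring]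
    refine HasSum.sum ?_ ?_
    · simpa [Function.comp_def] using h1.add (hasSum_halfGeom_odd hr)
    · refine hasSum_of_forall_eq ((hasSum_halfGeom_even hr).sub h1) fun j => ?_
      rcases lt_trichotomy j (-1) with h | rfl | h
      · simp [h.ne, halfGeom_of_neg (show 2 * j + 2 < 0 by omega)]
      · simp [halfGeom_zero]
      · simp [h.ne', show 0 ≤ j by omega]
  · simp [port]
  · simp [port]
  · intro b
    fin_cases b
    · simp [port, halfGeom_of_neg]
    · simp [port]
  · rintro (j | j) <;> by_cases h : 0 ≤ j
    · have := halfGeom_succ r (n := 2 * j + 2) (by omega)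
      rw [add_assoc, show (2 : ℤ) + 1 = 3 by norm_num] at this
      simp [mirrorSign, mirrorPerm, h, this]
      ring
    · by_cases h1 : j = -1
      · subst h1
        have := halfGeom_succ r le_rfl
        rw [halfGeom_zero, zero_add, mul_one] at this
        simp [mirrorSign, mirrorPerm, this, halfGeom_of_neg]
        ring
      · simp [mirrorSign, mirrorPerm, h, h1, halfGeom_of_neg (show 2 * j + 1 < 0 by omega),
          halfGeom_of_neg (show 2 * j + 3 < 0 by omega)]
    · have := halfGeom_succ r (n := 2 * j) (by omega)
      have h1 : j ≠ -1 := by omega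
      simp [mirrorSign, mirrorPerm, h, h1, this]
      ring
    · simp [mirrorSign, mirrorPerm, h, halfGeom_of_neg (show 2 * j < 0 by omega)]
  · rintro (j | j)
    · have e : 2 * (j + 1) + 2 = 2 * j + 3 + 1 := by ring
      by_cases h : 0 ≤ j + 1
      · have := halfGeom_succ r (n := 2 * j + 3) (by omega)
        simp [crossSign, crossPerm, e, this, h]
        ring
      · simp [crossSign, crossPerm, h, halfGeom_of_neg (show 2 * j + 3 < 0 by omega)]
    · have e : 2 * (j - 1) + 1 = 2 * j - 1 := by ring
      rcases lt_trichotomy j 0 with h | rfl | h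
      · simp [crossSign, crossPerm, e, h.ne, halfGeom_of_neg (show 2 * j < 0 by omega),
          halfGeom_of_neg (show 2 * j - 1 < 0 by omega)]
      · simp [crossSign, crossPerm, halfGeom_zero, halfGeom_of_neg]
      · have := halfGeom_succ r (n := 2 * j - 1) (by omega)
        rw [sub_add_cancel] at this
        simp [crossSign, crossPerm, e, h.ne', this]
        ring
  · rintro (j | j)
    · by_cases h : j = -1 <;> simp [shiftRight, port, h]
    · have e : 2 * (j + 1) = 2 * j + 2 := by ring
      rcases lt_trichotomy j (-1) with h | rfl | h
      · simp [shiftRight, port, e, h.ne, halfGeom_of_neg (show 2 * j + 2 < 0 by omega)]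
      · simp [shiftRight, port, halfGeom_zero]
      · simp [shiftRight, port, e, h.ne', show 0 ≤ j by omega]
  · rintro (j | j)
    · have e : 2 * (j - 1) + 3 = 2 * j + 1 := by ring
      simp [shiftLeft, e]
    · simp [shiftLeft]

end

/-! ### Choice of the ratio and evaluation of the complexities -/

theorem corollary3p6 :
    ∃ C : ℝ, 0 < C ∧
      ∀ (W : Type u) [NormedAddCommGroup W] [InnerProductSpace ℂ W] [CompleteSpace W]
        (w₀ : W), ‖w₀‖ = 1 →
        ∃ (L : Type u) (_ : NormedAddCommGroup L) (_ : InnerProductSpace ℂ L)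
          (_ : CompleteSpace L)
          (S : Transducer.{u, 0, u} (WithLp 2 (QubitTensor W × QubitTensor W)) Qubit L),
          ¬ FiniteDimensional ℂ L ∧
          ∀ (O : QubitTensor W ≃ₗᵢ[ℂ] QubitTensor W) (p : ℝ),
            IsStateGenerating w₀ O p → p ≠ 1 / 2 →
            ∃ c : L,
              (p < 1 / 2 → S.Transduces (bidirectional O) (ket 0) (ket 0) c) ∧
              (1 / 2 < p → S.Transduces (bidirectional O) (ket 0) (ket 1) c) ∧
              S.queryComplexity (bidirectional O) (ket 0) c = 1 + 1 / (2 * |1 / 2 - p|) ∧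
              transductionComplexity c ≤ C / |1 / 2 - p| := by
  -- `T - 1` is `min(p, 1 - p) / (2δ)`, so `C = 1` is ample.
  refine ⟨1, one_pos, fun W _ _ _ w₀ hw => ⟨PurifierSpace W, inferInstance, inferInstance,
    inferInstance, purifier w₀, purifierSpace_infinite hw, ?_⟩⟩
  rintro O p ⟨hp0, hp1, φ₀, φ₁, hφ₀, hφ₁, hO⟩ hp
  have hx2 : √(1 - p) ^ 2 = 1 - p := Real.sq_sqrt (by linarith)
  have hy2 : √p ^ 2 = p := Real.sq_sqrt hp0
  have hxy : √(1 - p) ^ 2 + √p ^ 2 = 1 := by rw [hx2, hy2]; ring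
  rcases lt_or_gt_of_ne hp with h | h
  · have hx : √(1 - p) ≠ 0 := (Real.sqrt_pos.2 (by linarith)).ne'
    have hr : (√p / √(1 - p)) ^ 2 = p / (1 - p) := by rw [div_pow, hx2, hy2]
    -- The ratio is `r = √p / √(1 - p)`, and `r² < 1` is exactly `p < 1/2`.
    obtain ⟨c, ht, hq, hc⟩ := exists_catalyst_lt hw hφ₀ hφ₁ hxy hO
      (div_mul_cancel₀ _ hx).symm (by rw [hr, div_lt_one (by linarith)]; linarith)
    rw [hr] at hq hc
    have hT : 1 / (1 - p / (1 - p)) = (1 - p) / (1 - 2 * p) := by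
      have : 1 - p ≠ 0 := by linarith
      rw [one_sub_div this, one_div_div]
      ring_nf
    have hδ : |1 / 2 - p| = (1 - 2 * p) / 2 := by
      rw [abs_of_pos (by linarith)]
      ring
    have hpos : 0 < 1 - 2 * p := by linarith
    refine ⟨c, fun _ => ht, fun h' => absurd h h'.not_gt, ?_, ?_⟩
    · rw [hq, hT, hδ]
      field_simp
      ring
    · rw [transductionComplexity, hc, hT, hδ, div_div_eq_mul_div, div_sub_one hpos.ne']
      gcongr
      linarith
  · have hy : √p ≠ 0 := (Real.sqrt_pos.2 (by linarith)).ne'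
    have hr : (√(1 - p) / √p) ^ 2 = (1 - p) / p := by rw [div_pow, hx2, hy2]
    obtain ⟨c, ht, hq, hc⟩ := exists_catalyst_gt hw hφ₀ hφ₁ hxy hO
      (div_mul_cancel₀ _ hy).symm (by rw [hr, div_lt_one (by linarith)]; linarith)
    rw [hr] at hq hc
    have hT : 1 / (1 - (1 - p) / p) = p / (2 * p - 1) := by
      have : p ≠ 0 := by linarith
      rw [one_sub_div this, one_div_div]
      ring_nf
    have hδ : |1 / 2 - p| = (2 * p - 1) / 2 := by
      rw [abs_of_neg (by linarith)]
      ring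
    have hpos : 0 < 2 * p - 1 := by linarith
    refine ⟨c, fun h' => absurd h h'.not_gt, fun _ => ht, ?_, ?_⟩
    · rw [hq, hT, hδ]
      field_simp
      ring
    · rw [transductionComplexity, hc, hT, hδ, div_div_eq_mul_div, div_sub_one hpos.ne']
      gcongr
      linarith

end
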